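/- An \emph{analytic space} is a separable metrizable space $X$ that is empty or a continuous image of the Baire space $\omega^\omega$. For a separable metrizable space $X$ let $\mathcal F(X)$ be the set of all closed subsets of $X$, and let $\mathcal F_0(X)$ be the set of those $F\in\mathcal F(X)$ that are zero-dimensional, i.e. whose relatively clopen subsets form a basis of the topology of $F$ (so $\emptyset\in\mathcal F_0(X)$). The \emph{Effros Borel structure} on $\mathcal F(X)$ is the $\sigma$-algebra generated by the sets $\{F: F\cap U\neq\emptyset\}$, $U\subset X$ open. A topology on $\mathcal F(X)$ is \emph{admissible} if there is an embedding $e$ of $X$ in a compact metrizable space $K$ such that it is the topology induced by the map $F\mapsto\overline{e(F)}$ into the set of closed subsets of $K$ with the Vietoris topology. A subset of a Polish space $Z$ is $\boldsymbol\Sigma^1_2$ if it is the projection to $Z$ of a co-analytic subset of $Z\times\omega^\omega$. Let $Y$ be a topological (resp. Borel) space that is homeomorphic (resp. Borel isomorphic) to a subspace of a Polish space. A subset $S$ of $Y$ is called $\boldsymbol\Sigma^1_2$ if for every Polish space $Z$ and every homeomorphism (resp. Borel isomorphism) $j$ of $Y$ onto a subspace of $Z$, the set $j(S)$ is a $\boldsymbol\Sigma^1_2$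 subset of $Z$. A subset $S$ of a topological space $Y$ is \emph{$\boldsymbol\Sigma^1_2$-hard} if for every $\boldsymbol\Sigma^1_2$ set $A\subset 2^\omega$ there is a continuous map $\varphi:2^\omega\to Y$ with $A=\varphi^{-1}(S)$; it is \emph{$\boldsymbol\Sigma^1_2$-complete} if it is $\boldsymbol\Sigma^1_2$ and $\boldsymbol\Sigma^1_2$-hard. \textbf{Theorem.} (1) For every analytic space $X$, the Effros Borel space $\mathcal F(X)$ is Borel isomorphic to a subspace of a Polish space, and $\mathcal F_0(X)$ is $\boldsymbol\Sigma^1_2$ in it; likewise, for every admissible topology, $\mathcal F(X)$ embeds topologically in a Polish space, and $\mathcal F_0(X)$ is $\boldsymbol\Sigma^1_2$ in $\mathcal F(X)$ with that topology. (2) There is an analytic set $X\subset 2^\omega\times[0,1]$ such that, for every admissible topology on $\mathcal F(X)$, the set $\mathcal F_0(X)$ is $\boldsymbol\Sigma^1_2$-complete. Hence the maximum complexity of $\mathcal F_0(X)$ over analytic spaces $X$ is exactly $\boldsymbol\Sigma^1_2$. -/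

import Mathlib

open Set TopologicalSpace MeasureTheory

universe u v

/-- Boldface `Σ¹₂` (`PCA`) subsets of a Polish space `Z`: projections along the Baire space `ℕ → ℕ`
of co-analytic subsets of `Z × (ℕ → ℕ)`. -/
def IsPCA {Z : Type v} [TopologicalSpace Z] (A : Set Z) : Prop :=
  ∃ C : Set (Z × (ℕ → ℕ)), AnalyticSet Cᶜ ∧ A = Prod.fst '' C

/-- The Effros Borel structure on the set `Closeds X` of all closed subsets of `X`. -/
@[reducible] def effrosBorel (X : Type u) [TopologicalSpace X] : MeasurableSpace (Closeds X) :=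
  MeasurableSpace.generateFrom
    {S | ∃ U : Set X, IsOpen U ∧ S = {F : Closeds X | ((F : Set X) ∩ U).Nonempty}}

/-- The topology on `Closeds X` defined by a map `e : X → K`: `F` is identified with the closure of
`e '' F` in `K`, and the closed subsets of `K` carry the Vietoris topology. -/
@[reducible] def hyperspaceTopology {X : Type u} [TopologicalSpace X] {K : Type v} [TopologicalSpace K]
    (e : X → K) : TopologicalSpace (Closeds X) :=
  (TopologicalSpace.vietoris K).induced fun F : Closeds X => closure (e '' (F : Set X))

/-- Admissible topologies on `Closeds X`: those given by an embedding (not necessarily with dense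
range) of `X` into a compact metrizable space. -/
def IsAdmissible {X : Type u} [TopologicalSpace X] (t : TopologicalSpace (Closeds X)) : Prop :=
  ∃ (K : Type v) (_ : TopologicalSpace K) (_ : CompactSpace K) (_ : MetrizableSpace K) (e : X → K),
    Topology.IsEmbedding e ∧ t = hyperspaceTopology e

/-- The set of all closed zero-dimensional subsets of `X`. A set is zero-dimensional when its
clopen subsets form a basis (dimension at most `0`); in particular the empty set belongs to it. -/
def closedZeroDim (X : Type u) [TopologicalSpace X] : Set (Closeds X) :=
  {F | HasSmallInductiveDimensionLE F 0}

/-- A subset `S` of a space `(Y, t)` is absolutely `Σ¹₂`: the space embeds in some Polish space, and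
for every embedding `j` of it in a Polish space `Z` the set `j '' S` is `Σ¹₂` in `Z`. -/
def IsSigma12 {Y : Type u} (t : TopologicalSpace Y) (S : Set Y) : Prop :=
  (∃ (Z : Type v) (_ : TopologicalSpace Z) (_ : PolishSpace Z) (j : Y → Z),
    Topology.IsEmbedding j) ∧
  ∀ (Z : Type v) [TopologicalSpace Z] [PolishSpace Z] (j : Y → Z),
    Topology.IsEmbedding j → IsPCA (j '' S)

/-- The same for a Borel space `(Y, m)`: it is Borel isomorphic to a subspace of some Polish space,
and whenever `j` is a Borel isomorphism of it with a subspace of a Polish space `Z`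
the set `j '' S` is `Σ¹₂` in `Z`. -/
def IsBorelSigma12 {Y : Type u} (m : MeasurableSpace Y) (S : Set Y) : Prop :=
  (∃ (Z : Type v) (_ : TopologicalSpace Z) (_ : PolishSpace Z) (j : Y → Z),
    Function.Injective j ∧ (borel Z).comap j = m) ∧
  ∀ (Z : Type v) [TopologicalSpace Z] [PolishSpace Z] (j : Y → Z),
    Function.Injective j → (borel Z).comap j = m → IsPCA (j '' S)

/-- `S ⊆ (Y, t)` is `Σ¹₂`-hard: every `Σ¹₂` subset of the Cantor space is the preimage of `S` under
a continuous map from the Cantor space to `Y`. -/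
def IsSigma12Hard {Y : Type u} (t : TopologicalSpace Y) (S : Set Y) : Prop :=
  ∀ A : Set (ℕ → Bool), IsPCA A →
    ∃ φ : (ℕ → Bool) → Y, Continuous φ ∧ A = φ ⁻¹' S

/-- `Σ¹₂`-complete: `Σ¹₂` and `Σ¹₂`-hard. -/
def IsSigma12Complete {Y : Type u} (t : TopologicalSpace Y) (S : Set Y) : Prop :=
  IsSigma12.{u, v} t S ∧ IsSigma12Hard t S

/-! Upper bound: a closed set is coded by the set of indices of the basic open sets it meets. Being
zero-dimensional means that some `p` codes clopen partitions which split every basic set; the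
condition on `p` at a point is Borel, and points are parametrized by the Baire space, so "for all
points" is co-analytic and "for some `p`" gives `Σ¹₂` (`isPCA_closedsCode_image`). The code
generates the Effros structure, which is also the Borel structure of every admissible topology
(`borel_hyperspaceTopology`), so the bound passes to all embeddings (`isPCA_image_of_comap_eq`).

Hardness: with `V` universal and `rowLimsup` Borel with dense fibers, the section of
`sigma12HardSpace V` over `x` outside `eventuallyFalse` is the whole interval if the section of `V`
at `parityDecode x` is full, and otherwise omits a dense set, hence is zero-dimensional. The clause
on `rowLimsup q.2 0` makes all sections dense; those over `eventuallyFalse` are full. Hence, for any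
embedding, sections vary continuously over some `Gδ` set containing `eventuallyFalse`
(`exists_continuous_fiberCloseds`). This `Gδ` depends on the embedding but the space must not, so
the decoding has continuous right inverses into every such `Gδ`
(`exists_continuous_parityDecode_eq`). -/

instance instPolishSpaceCantor {ι : Type*} [Countable ι] : PolishSpace (ι → Bool) :=
  @instPolishSpaceOfSeparableSpaceOfIsCompletelyMetrizableSpace _ _ inferInstance inferInstance

/-! ### Closure properties of `Σ¹₂` sets -/

/-- Preimages of analytic sets under Borel maps are analytic. -/
theorem MeasureTheory.AnalyticSet.preimage_of_measurable {Z Z' : Type*} [TopologicalSpace Z] [PolishSpace Z]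
    [MeasurableSpace Z] [BorelSpace Z] [TopologicalSpace Z'] [PolishSpace Z'] [MeasurableSpace Z']
    [BorelSpace Z'] {A : Set Z'} (hA : AnalyticSet A) {f : Z → Z'} (hf : Measurable f) :
    AnalyticSet (f ⁻¹' A) := by
  rw [AnalyticSet] at hA
  rcases hA with rfl | ⟨g, hg, rfl⟩
  · simpa using analyticSet_empty
  have h : f ⁻¹' range g = Prod.fst '' {q : Z × (ℕ → ℕ) | g q.2 = f q.1} := by
    ext z
    simp
  rw [h]
  refine MeasurableSet.analyticSet_image ?_ measurable_fst
  exact measurableSet_eq_fun (hg.measurable.comp measurable_snd) (hf.comp measurable_fst)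

theorem MeasureTheory.AnalyticSet.union {Z : Type*} [TopologicalSpace Z] {A B : Set Z} (hA : AnalyticSet A)
    (hB : AnalyticSet B) : AnalyticSet (A ∪ B) := by
  rw [union_eq_iUnion]
  exact AnalyticSet.iUnion fun b => by cases b <;> assumption

/-- The parameter space in the definition of `Σ¹₂` sets may be any nonempty Polish space. -/
theorem isPCA_image_fst {Z : Type v} {W : Type*} [TopologicalSpace Z] [PolishSpace Z]
    [TopologicalSpace W] [PolishSpace W] [Nonempty W] {C : Set (Z × W)} (hC : AnalyticSet Cᶜ) :
    IsPCA (Prod.fst '' C) := by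
  obtain ⟨g, hg, hs⟩ := PolishSpace.exists_nat_nat_continuous_surjective W
  refine ⟨(fun q => (q.1, g q.2)) ⁻¹' C, ?_, ?_⟩
  · rw [← preimage_compl]
    exact hC.preimage (by fun_prop)
  · ext z
    simp only [mem_image, Prod.exists, exists_and_right, exists_eq_right, mem_preimage]
    exact ⟨fun ⟨w, hw⟩ => (hs w).imp fun y hy => by rwa [hy], fun ⟨y, hy⟩ => ⟨_, hy⟩⟩

theorem MeasureTheory.AnalyticSet.isPCA {Z : Type v} [TopologicalSpace Z] [PolishSpace Z] {A : Set Z}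
    (hA : AnalyticSet A) : IsPCA A := by
  rw [AnalyticSet] at hA
  rcases hA with rfl | ⟨g, hg, rfl⟩
  · exact ⟨∅, by simpa using isClosed_univ.analyticSet, by simp⟩
  · refine ⟨{q | g q.2 = q.1}, ?_, by ext z; simp⟩
    borelize Z
    exact ((isClosed_eq (hg.comp continuous_snd) continuous_fst).isOpen_compl.measurableSet).analyticSet

theorem IsPCA.inter {Z : Type v} [TopologicalSpace Z] [PolishSpace Z] {A B : Set Z}
    (hA : IsPCA A) (hB : IsPCA B) : IsPCA (A ∩ B) := by
  obtain ⟨C, hC, rfl⟩ := hA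
  obtain ⟨D, hD, rfl⟩ := hB
  have h : Prod.fst '' C ∩ Prod.fst '' D = Prod.fst ''
      {q : Z × ((ℕ → ℕ) × (ℕ → ℕ)) | (q.1, q.2.1) ∈ C ∧ (q.1, q.2.2) ∈ D} := by
    ext z
    simp
  rw [h]
  refine isPCA_image_fst ?_
  rw [ofPred_and, compl_inter]
  exact AnalyticSet.union
    (hC.preimage (f := fun q : Z × ((ℕ → ℕ) × (ℕ → ℕ)) => (q.1, q.2.1)) (by fun_prop))
    (hD.preimage (f := fun q : Z × ((ℕ → ℕ) × (ℕ → ℕ)) => (q.1, q.2.2)) (by fun_prop))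

theorem IsPCA.preimage {Z : Type u} {Z' : Type v} [TopologicalSpace Z] [PolishSpace Z]
    [MeasurableSpace Z] [BorelSpace Z] [TopologicalSpace Z'] [PolishSpace Z'] [MeasurableSpace Z']
    [BorelSpace Z'] {A : Set Z'} (hA : IsPCA A) {f : Z → Z'} (hf : Measurable f) :
    IsPCA (f ⁻¹' A) := by
  obtain ⟨C, hC, rfl⟩ := hA
  refine ⟨(fun q => (f q.1, q.2)) ⁻¹' C, ?_, ?_⟩
  · rw [← preimage_compl]
    exact AnalyticSet.preimage_of_measurable hC (by fun_prop)
  · ext z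
    simp

/-- If a Borel space is coded by `c` in the Cantor space, then sets with `Σ¹₂` codes have `Σ¹₂`
images under all Borel isomorphisms with subspaces of Polish spaces. -/
theorem isPCA_image_of_comap_eq {Y : Type*} {Z : Type v} [TopologicalSpace Z] [PolishSpace Z]
    {c : Y → ℕ → Bool} {j : Y → Z} (h : (borel Z).comap j = MeasurableSpace.pi.comap c) {S : Set Y}
    (hS : IsPCA (c '' S)) : IsPCA (j '' S) := by
  borelize Z
  have h1 (n : ℕ) : ∃ B : Set Z, MeasurableSet B ∧ j ⁻¹' B = {y | c y n = true} := by
    have : MeasurableSet[MeasurableSpace.pi.comap c] {y | c y n = true} :=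
      ⟨{x | x n = true}, measurableSet_eq_fun (measurable_pi_apply n) measurable_const, rfl⟩
    rwa [← h] at this
  choose B hB hB' using h1
  obtain ⟨b, hbc, -, hb⟩ := exists_countable_basis Z
  have h2 (V : b) : ∃ W : Set (ℕ → Bool), MeasurableSet W ∧ c ⁻¹' W = j ⁻¹' V := by
    have : MeasurableSet[(borel Z).comap j] (j ⁻¹' V) :=
      ⟨V, (hb.isOpen V.2).measurableSet, rfl⟩
    rwa [h] at this
  choose W hW hW' using h2
  have := hbc.to_subtype
  classical
  let f : Z → ℕ → Bool := fun z n => decide (z ∈ B n)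
  have hf : Measurable f := measurable_pi_lambda _ fun n =>
    measurable_to_bool (by convert hB n using 1; ext; simp [f])
  have hfj (y : Y) : f (j y) = c y := by
    ext n
    have : j y ∈ B n ↔ c y n = true := by rw [← mem_preimage, hB']; rfl
    simp [f, this]
  -- A point `z` outside the range of `j` may share its `f`-value with some `j y`. This Borel
  -- condition excludes it: here `f z` determines the basic sets containing `z`.
  have hR : MeasurableSet {z : Z | ∀ V : b, z ∈ (V : Set Z) ↔ f z ∈ W V} := by
    rw [ofPred_forall]
    exact MeasurableSet.iInter fun V => MeasurableSet.iff (hb.isOpen V.2).measurableSet (hf (hW V))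
  have hmem (y : Y) (V : b) : j y ∈ (V : Set Z) ↔ c y ∈ W V := by
    rw [← mem_preimage, ← hW']
    rfl
  have hcode : j '' S = f ⁻¹' (c '' S) ∩ {z : Z | ∀ V : b, z ∈ (V : Set Z) ↔ f z ∈ W V} := ?_
  · rw [hcode]
    exact (hS.preimage hf).inter hR.analyticSet.isPCA
  ext z
  constructor
  · rintro ⟨y, hy, rfl⟩
    exact ⟨⟨y, hy, (hfj y).symm⟩, fun V => by rw [hfj, hmem]⟩
  · rintro ⟨⟨y, hy, hyz⟩, hz⟩
    refine ⟨y, hy, hb.eq_iff.2 fun V hV => ?_⟩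
    rw [hmem y ⟨V, hV⟩, hz ⟨V, hV⟩, hyz]

/-! ### Coding closed sets and their zero-dimensionality -/

theorem exists_seq_isTopologicalBasis (X : Type*) [TopologicalSpace X] [SecondCountableTopology X] :
    ∃ B : ℕ → Set X, IsTopologicalBasis (range B) := by
  obtain ⟨b, hb, -, hB⟩ := exists_countable_basis X
  obtain ⟨B, h⟩ := (hb.insert ∅).exists_eq_range (insert_nonempty _ _)
  exact ⟨B, h ▸ hB.insert_empty⟩

/-- The code of a closed set, relative to a sequence of sets. -/
noncomputable def closedsCode {X : Type*} [TopologicalSpace X] (B : ℕ → Set X) (F : Closeds X) :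
    ℕ → Bool := by
  classical exact fun n => decide ((F : Set X) ∩ B n).Nonempty

section
variable {X : Type u} [TopologicalSpace X] {B : ℕ → Set X}

theorem closedsCode_eq_true_iff {F : Closeds X} {n : ℕ} :
    closedsCode B F n = true ↔ ((F : Set X) ∩ B n).Nonempty := by
  simp [closedsCode]

theorem exists_basis_index (hB : IsTopologicalBasis (range B)) {x : X} {U : Set X} (hU : IsOpen U)
    (hx : x ∈ U) : ∃ n, x ∈ B n ∧ B n ⊆ U := by
  obtain ⟨_, ⟨n, rfl⟩, h, h'⟩ := hB.exists_subset_of_mem_open hx hU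
  exact ⟨n, h, h'⟩

theorem mem_iff_closedsCode (hB : IsTopologicalBasis (range B)) {F : Closeds X} {x : X} :
    x ∈ F ↔ ∀ n, x ∈ B n → closedsCode B F n = true := by
  simp only [closedsCode_eq_true_iff]
  refine ⟨fun hx n hn => ⟨x, hx, hn⟩, fun h => ?_⟩
  by_contra hx
  obtain ⟨n, hn, hn'⟩ := exists_basis_index hB F.isClosed.isOpen_compl hx
  obtain ⟨y, hy, hy'⟩ := h n hn
  exact hn' hy' hy

theorem comap_closedsCode (hB : IsTopologicalBasis (range B)) :
    MeasurableSpace.pi.comap (closedsCode B) = effrosBorel X := by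
  apply le_antisymm
  · rw [← measurable_iff_comap_le]
    refine @measurable_pi_lambda _ _ _ (effrosBorel X) _ _ fun n => ?_
    refine @measurable_to_bool _ (effrosBorel X) _ ?_
    refine MeasurableSpace.measurableSet_generateFrom ⟨B n, hB.isOpen ⟨n, rfl⟩, ?_⟩
    ext F
    simp [closedsCode]
  · refine MeasurableSpace.generateFrom_le ?_
    rintro _ ⟨U, hU, rfl⟩
    refine ⟨⋃ n ∈ {n | B n ⊆ U}, {x | x n = true}, ?_, ?_⟩
    · exact MeasurableSet.biUnion (to_countable _) fun n _ =>
        measurableSet_eq_fun (measurable_pi_apply n) measurable_const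
    · ext F
      simp only [preimage_iUnion, mem_iUnion, mem_preimage, mem_ofPred_eq, closedsCode_eq_true_iff]
      constructor
      · rintro ⟨n, hn, x, hx, hx'⟩
        exact ⟨x, hx, hn hx'⟩
      · rintro ⟨x, hx, hx'⟩
        obtain ⟨n, hn, hn'⟩ := exists_basis_index hB hU hx'
        exact ⟨n, hn', x, hx, hn⟩

/-- `p` codes, for all `n` and `m`, a pair of disjoint open sets which cover a point `x`, such that
the first sets belonging to `n` cover `x` just when `x` is in `B n`. -/
def PartitionsAt (B : ℕ → Set X) (p : ℕ × ℕ × Bool × ℕ → Bool) (x : X) : Prop :=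
  ∀ n,
    (∀ m, ((∃ i, p (n, m, true, i) = true ∧ x ∈ B i) ↔ ¬ ∃ i, p (n, m, false, i) = true ∧ x ∈ B i) ∧
      ((∃ i, p (n, m, true, i) = true ∧ x ∈ B i) → x ∈ B n)) ∧
    (x ∈ B n → ∃ m i, p (n, m, true, i) = true ∧ x ∈ B i)

/-- By second countability, zero-dimensionality says that every basic open set has as its trace on
`F` a countable union of relatively clopen sets. Each of these and its complement are traces of
unions of basic sets, so countably many bits record everything. -/
theorem exists_partitionsAt_iff [SecondCountableTopology X] (hB : IsTopologicalBasis (range B))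
    (F : Set X) :
    (∃ p, ∀ x ∈ F, PartitionsAt B p x) ↔ HasSmallInductiveDimensionLE F 0 := by
  refine Iff.trans ?_ (hasSmallInductiveDimensionLT_one_iff (X := F)).symm
  have hBo (i : ℕ) : IsOpen (B i) := hB.isOpen ⟨i, rfl⟩
  constructor
  · rintro ⟨p, hp⟩
    refine isTopologicalBasis_of_isOpen_of_nhds (fun _ h => h.2) ?_
    rintro ⟨x, hx⟩ _ hxU ⟨U, hU, rfl⟩
    obtain ⟨n, hn, hnU⟩ := exists_basis_index hB hU hxU
    obtain ⟨m, hm⟩ := (hp x hx n).2 hn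
    have hopen (b : Bool) : IsOpen {y : F | ∃ i, p (n, m, b, i) = true ∧ (y : X) ∈ B i} := by
      simp only [ofPred_exists, ofPred_and]
      exact isOpen_iUnion fun i => isOpen_const.inter ((hBo i).preimage continuous_subtype_val)
    refine ⟨{y : F | ∃ i, p (n, m, true, i) = true ∧ (y : X) ∈ B i}, ⟨⟨?_⟩, hopen true⟩, hm, ?_⟩
    · convert hopen false using 1
      ext y
      exact (not_congr ((hp y y.2 n).1 m).1).trans not_not
    · exact fun y hy => hnU (((hp y y.2 n).1 m).2 hy)
  · intro h
    have h1 (n : ℕ) : ∃ V : ℕ → Set F, (∀ m, IsClopen (V m)) ∧ ⋃ m, V m = (↑) ⁻¹' B n := by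
      obtain ⟨S, hS, hS'⟩ := h.open_eq_sUnion ((hBo n).preimage continuous_subtype_val)
      obtain ⟨T, hT, hTS, hTU⟩ := isOpen_sUnion_countable S fun s hs => (hS hs).2
      obtain ⟨V, hV⟩ := (hT.insert ∅).exists_eq_range (insert_nonempty _ _)
      refine ⟨V, fun m => ?_, ?_⟩
      · have : V m ∈ insert ∅ T := hV ▸ mem_range_self m
        rcases this with h | h
        · exact h ▸ isClopen_empty
        · exact hS (hTS h)
      · rw [hS', ← hTU, ← sUnion_range, ← hV]
        simp
    choose V hV hVB using h1
    have h2 (n m : ℕ) (b : Bool) : ∃ O : Set X, IsOpen O ∧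
        (↑) ⁻¹' O = (if b then V n m else (V n m)ᶜ) := by
      cases b
      · exact (hV n m).1.isOpen_compl
      · exact (hV n m).2
    choose O hO hOV using h2
    classical
    have h3 (n m : ℕ) (b : Bool) (x : F) :
        (∃ i, decide (B i ⊆ O n m b) = true ∧ (x : X) ∈ B i) ↔ x ∈ (if b then V n m else (V n m)ᶜ) := by
      rw [← hOV, mem_preimage]
      constructor
      · rintro ⟨i, hi, hx⟩
        exact of_decide_eq_true hi hx
      · intro hx
        obtain ⟨i, hi, hi'⟩ := exists_basis_index hB (hO n m b) hx
        exact ⟨i, decide_eq_true hi', hi⟩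
    refine ⟨fun q => decide (B q.2.2.2 ⊆ O q.1 q.2.1 q.2.2.1), fun x hx n => ?_⟩
    have h4 : x ∈ B n ↔ ∃ m, (⟨x, hx⟩ : F) ∈ V n m := by
      rw [← mem_iUnion, hVB]
      rfl
    have h5 (m : ℕ) := h3 n m true ⟨x, hx⟩
    have h6 (m : ℕ) := h3 n m false ⟨x, hx⟩
    simp only [if_true] at h5
    simp only [Bool.false_eq_true, if_false] at h6
    simp only [h5, h6, h4, mem_compl_iff, not_not, true_and]
    exact ⟨fun m h => ⟨m, h⟩, id⟩

theorem isPCA_closedsCode_image [SecondCountableTopology X] (hB : IsTopologicalBasis (range B))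
    (hX : AnalyticSet (univ : Set X)) : IsPCA (closedsCode B '' closedZeroDim X) := by
  have hBo (i : ℕ) : IsOpen (B i) := hB.isOpen ⟨i, rfl⟩
  rw [AnalyticSet] at hX
  rcases hX with hX | ⟨g, hg, hgX⟩
  · have : IsEmpty X := univ_eq_empty_iff.1 hX
    have : Subsingleton (Closeds X) := ⟨fun F G => Closeds.ext (Subsingleton.elim _ _)⟩
    exact (subsingleton_of_subsingleton.image _).measurableSet.analyticSet.isPCA
  have hgB (i : ℕ) {α : Type} [MeasurableSpace α] {k : α → ℕ → ℕ} (hk : Measurable k) :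
      Measurable fun a => g (k a) ∈ B i :=
    measurableSet_setOfPred.1 (((hBo i).preimage hg).measurableSet.preimage hk)
  have hev {α ι : Type} [MeasurableSpace α] {k : α → ι → Bool} (i : ι) (hk : Measurable k) :
      Measurable fun a => k a i = true :=
    measurableSet_setOfPred.1 (measurableSet_eq_fun ((measurable_pi_apply i).comp hk) measurable_const)
  let Good : Set ((ℕ → Bool) × (ℕ × ℕ × Bool × ℕ → Bool)) :=
    {q | ∀ w, (∀ i, g w ∈ B i → q.1 i = true) → PartitionsAt B q.2 (g w)}
  have hGood : AnalyticSet Goodᶜ := by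
    have : Goodᶜ = (fun q : ((ℕ → Bool) × (ℕ × ℕ × Bool × ℕ → Bool)) × (ℕ → ℕ) => q.1) ''
        {q | ¬ ((∀ i, g q.2 ∈ B i → q.1.1 i = true) → PartitionsAt B q.1.2 (g q.2))} := by
      ext q
      simp [Good]
    rw [this]
    refine MeasurableSet.analyticSet_image (measurableSet_setOfPred.2 ?_) measurable_fst
    have hp (r) : Measurable fun q : ((ℕ → Bool) × (ℕ × ℕ × Bool × ℕ → Bool)) × (ℕ → ℕ) =>
      q.1.2 r = true := hev r (by fun_prop)
    have ha (r) : Measurable fun q : ((ℕ → Bool) × (ℕ × ℕ × Bool × ℕ → Bool)) × (ℕ → ℕ) =>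
      q.1.1 r = true := hev r (by fun_prop)
    have hx (i) : Measurable fun q : ((ℕ → Bool) × (ℕ × ℕ × Bool × ℕ → Bool)) × (ℕ → ℕ) =>
      g q.2 ∈ B i := hgB i (by fun_prop)
    have hO (n m : ℕ) (b : Bool) :
        Measurable fun q : ((ℕ → Bool) × (ℕ × ℕ × Bool × ℕ → Bool)) × (ℕ → ℕ) =>
          ∃ i, q.1.2 (n, m, b, i) = true ∧ g q.2 ∈ B i :=
      Measurable.exists fun i => (hp _).and (hx i)
    refine (Measurable.imp (Measurable.forall fun i => (hx i).imp (ha i)) ?_).not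
    exact Measurable.forall fun n => (Measurable.forall fun m =>
      ((hO n m true).iff (hO n m false).not).and ((hO n m true).imp (hx n))).and
      ((hx n).imp (Measurable.exists fun m => hO n m true))
  -- The sequence `a` is a code just when every true index `n` is witnessed by a point of `B n` all
  -- of whose basic neighborhoods have true indices. The witness is sought in the Baire space, so
  -- this is an analytic condition.
  let D : ℕ → Set (ℕ → Bool) := fun n =>
    (fun q : (ℕ → Bool) × (ℕ → ℕ) => q.1) ''
      {q | q.1 n = true → g q.2 ∈ B n ∧ ∀ i, g q.2 ∈ B i → q.1 i = true}
  have hD (n : ℕ) : AnalyticSet (D n) := by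
    refine MeasurableSet.analyticSet_image (measurableSet_setOfPred.2 ?_) measurable_fst
    have ha (r) : Measurable fun q : (ℕ → Bool) × (ℕ → ℕ) => q.1 r = true := hev r (by fun_prop)
    have hx (i) : Measurable fun q : (ℕ → Bool) × (ℕ → ℕ) => g q.2 ∈ B i := hgB i (by fun_prop)
    exact (ha n).imp ((hx n).and (Measurable.forall fun i => (hx i).imp (ha i)))
  have hsurj (x : X) : ∃ w, g w = x := by
    rw [← mem_range, hgX]
    trivial
  have heq : closedsCode B '' closedZeroDim X = Prod.fst '' Good ∩ ⋂ n, D n := by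
    ext a
    simp only [mem_inter_iff, mem_iInter]
    constructor
    · rintro ⟨F, hF, rfl⟩
      constructor
      · obtain ⟨p, hp⟩ := (exists_partitionsAt_iff hB (F : Set X)).2 hF
        exact ⟨(_, p), fun w hw => hp _ ((mem_iff_closedsCode hB).2 hw), rfl⟩
      · intro n
        by_cases hn : closedsCode B F n = true
        · obtain ⟨x, hx, hxn⟩ := closedsCode_eq_true_iff.1 hn
          obtain ⟨w, rfl⟩ := hsurj x
          exact ⟨(_, w), fun _ => ⟨hxn, (mem_iff_closedsCode hB).1 hx⟩, rfl⟩
        · exact ⟨(_, 0), fun h => absurd h hn, rfl⟩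
    · rintro ⟨⟨⟨a, p⟩, hp, rfl⟩, hD⟩
      let F : Closeds X := ⟨{x | ∀ i, x ∈ B i → a i = true}, by
        simp only [ofPred_forall]
        exact isClosed_iInter fun i => isOpen_compl_iff.1 (by
          convert (hBo i).inter (isOpen_const (p := ¬ a i = true)) using 1
          ext x
          simp)⟩
      refine ⟨F, ?_, ?_⟩
      · refine (exists_partitionsAt_iff hB (F : Set X)).1 ⟨p, fun x hx => ?_⟩
        obtain ⟨w, rfl⟩ := hsurj x
        exact hp w hx
      · ext n
        rw [Bool.eq_iff_iff, closedsCode_eq_true_iff]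
        refine ⟨fun ⟨x, hx, hxn⟩ => hx n hxn, fun hn => ?_⟩
        obtain ⟨⟨a', w⟩, hw, rfl⟩ := hD n
        exact ⟨g w, (hw hn).2, (hw hn).1⟩
  rw [heq]
  exact (isPCA_image_fst hGood).inter (AnalyticSet.iInter hD).isPCA

theorem isPCA_image_closedZeroDim [SecondCountableTopology X] (hX : AnalyticSet (univ : Set X))
    {Z : Type v} [TopologicalSpace Z] [PolishSpace Z] {j : Closeds X → Z}
    (hj : (borel Z).comap j = effrosBorel X) : IsPCA (j '' closedZeroDim X) := by
  obtain ⟨B, hB⟩ := exists_seq_isTopologicalBasis X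
  exact isPCA_image_of_comap_eq (hj.trans (comap_closedsCode hB).symm)
    (isPCA_closedsCode_image hB hX)

theorem isBorelSigma12_closedZeroDim [SecondCountableTopology X]
    (hX : AnalyticSet (univ : Set X)) :
    IsBorelSigma12.{u, v} (effrosBorel X) (closedZeroDim X) := by
  refine ⟨?_, fun Z _ _ j _ hj => isPCA_image_closedZeroDim hX hj⟩
  obtain ⟨B, hB⟩ := exists_seq_isTopologicalBasis X
  refine ⟨ULift.{v} (ℕ → Bool), inferInstance, Homeomorph.ulift.isClosedEmbedding.polishSpace,
    fun F => ULift.up (closedsCode B F), ?_, ?_⟩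
  · intro F G h
    have h : closedsCode B F = closedsCode B G := ULift.up_injective h
    exact Closeds.ext (Set.ext fun x => by
      simp only [SetLike.mem_coe, mem_iff_closedsCode hB, h])
  · rw [← comap_closedsCode hB]
    have h : borel (ULift.{v} (ℕ → Bool)) = (borel (ℕ → Bool)).comap ULift.down := by
      rw [← borel_comap]
    rw [h, MeasurableSpace.comap_comp, ← BorelSpace.measurable_eq (α := ℕ → Bool)]
    rfl

end

/-! ### Admissible topologies -/

theorem closure_image_inter_nonempty_iff {X K : Type*} [TopologicalSpace K] {e : X → K}
    {s : Set X} {V : Set K} (hV : IsOpen V) :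
    (closure (e '' s) ∩ V).Nonempty ↔ (s ∩ e ⁻¹' V).Nonempty := by
  rw [closure_inter_open_nonempty_iff hV, image_inter_nonempty_iff]

section
variable {X : Type u} [TopologicalSpace X] {K : Type v} [TopologicalSpace K] {e : X → K}

theorem Topology.IsEmbedding.preimage_closure_image (he : Topology.IsEmbedding e) {s : Set X}
    (hs : IsClosed s) : e ⁻¹' closure (e '' s) = s := by
  rw [← he.closure_eq_preimage_closure_image, hs.closure_eq]

/-- The embedding of `Closeds X` in the hyperspace of a compact space defining an admissible
topology. -/
def closureImage [CompactSpace K] (e : X → K) (F : Closeds X) : Compacts K :=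
  ⟨closure (e '' F), isClosed_closure.isCompact⟩

theorem isEmbedding_closureImage [CompactSpace K] (he : Topology.IsEmbedding e) :
    @Topology.IsEmbedding _ _ (hyperspaceTopology e) _ (closureImage e) := by
  let := hyperspaceTopology e
  refine ⟨⟨?_⟩, fun F G h => Closeds.ext ?_⟩
  · change (TopologicalSpace.vietoris K).induced _ =
      ((TopologicalSpace.vietoris K).induced _).induced _
    rw [induced_compose]
    rfl
  · rw [← he.preimage_closure_image F.isClosed, ← he.preimage_closure_image G.isClosed]
    exact congrArg (fun C : Compacts K => e ⁻¹' (C : Set K)) h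

theorem polishSpace_of_compactSpace (K : Type*) [TopologicalSpace K] [CompactSpace K]
    [MetrizableSpace K] : PolishSpace K := by
  let := metrizableSpaceMetric K
  infer_instance

theorem borel_hyperspaceTopology [CompactSpace K] [MetrizableSpace K]
    (he : Topology.IsEmbedding e) : @borel _ (hyperspaceTopology e) = effrosBorel X := by
  have := polishSpace_of_compactSpace K
  apply le_antisymm
  · let := hyperspaceTopology e
    have : SecondCountableTopology (Closeds X) :=
      (isEmbedding_closureImage he).secondCountableTopology
    have hgen : hyperspaceTopology e = generateFrom _ := induced_generateFrom_eq
    rw [borel_eq_generateFrom_of_subbasis hgen]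
    refine MeasurableSpace.generateFrom_le ?_
    let := effrosBorel X
    have hit {U : Set X} (hU : IsOpen U) : MeasurableSet {F : Closeds X | ((F : Set X) ∩ U).Nonempty} :=
      MeasurableSpace.measurableSet_generateFrom ⟨U, hU, rfl⟩
    rintro _ ⟨_, ⟨V, hV, rfl⟩ | ⟨V, hV, rfl⟩, rfl⟩
    · let := metrizableSpaceMetric K
      -- By compactness, a closed set contained in `V` has positive distance from `Vᶜ`, so it lies
      -- in some `C n`. For the closure of an image, lying in the closed set `C n` only means that
      -- `F` misses an open subset of `X`.
      let C : ℕ → Set K := fun n => (Metric.thickening (1 / (n + 1 : ℝ)) Vᶜ)ᶜ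
      have hC (n : ℕ) : IsClosed (C n) := Metric.isOpen_thickening.isClosed_compl
      have hCV (n : ℕ) : C n ⊆ V :=
        compl_subset_comm.1 (Metric.self_subset_thickening (by positivity) _)
      have h : (fun F : Closeds X => closure (e '' (F : Set X))) ⁻¹' 𝒫 V =
          ⋃ n, {F : Closeds X | ((F : Set X) ∩ e ⁻¹' (C n)ᶜ).Nonempty}ᶜ := by
        ext F
        simp only [mem_preimage, mem_powerset_iff, mem_iUnion, mem_compl_iff, mem_ofPred_eq,
          preimage_compl, inter_compl_nonempty_iff, not_not]
        constructor
        · intro h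
          obtain ⟨δ, hδ, hδ'⟩ := (disjoint_compl_right_iff_subset.2 h).exists_thickenings
            isClosed_closure.isCompact hV.isClosed_compl
          obtain ⟨n, hn⟩ := exists_nat_one_div_lt hδ
          refine ⟨n, fun x hx hx' => ?_⟩
          exact disjoint_left.1 hδ' (Metric.self_subset_thickening hδ _
            (subset_closure (mem_image_of_mem e hx))) (Metric.thickening_mono hn.le _ hx')
        · rintro ⟨n, hn⟩
          exact (closure_minimal (image_subset_iff.2 hn) (hC n)).trans (hCV n)
      rw [h]
      exact MeasurableSet.iUnion fun n =>
        (hit ((hC n).isOpen_compl.preimage he.continuous)).compl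
    · convert hit (hV.preimage he.continuous) using 1
      ext F
      exact closure_image_inter_nonempty_iff hV
  · refine MeasurableSpace.generateFrom_le ?_
    rintro _ ⟨U, hU, rfl⟩
    obtain ⟨V, hV, rfl⟩ := he.isOpen_iff.1 hU
    let := hyperspaceTopology e
    refine MeasurableSpace.measurableSet_generateFrom ?_
    refine ⟨_, vietoris.isOpen_inter_nonempty_of_isOpen hV, ?_⟩
    ext F
    exact closure_image_inter_nonempty_iff hV

theorem isSigma12_closedZeroDim [SecondCountableTopology X] (hX : AnalyticSet (univ : Set X))
    {t : TopologicalSpace (Closeds X)} (ht : IsAdmissible.{u, v} t) :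
    IsSigma12.{u, v} t (closedZeroDim X) := by
  obtain ⟨K, _, _, _, e, he, rfl⟩ := ht
  have := polishSpace_of_compactSpace K
  refine ⟨⟨Compacts K, inferInstance, polishSpace_of_compactSpace _, closureImage e,
    isEmbedding_closureImage he⟩, fun Z _ _ j hj => isPCA_image_closedZeroDim hX ?_⟩
  let := hyperspaceTopology e
  rw [← borel_hyperspaceTopology he, ← borel_comap]
  exact congrArg (@borel _) hj.eq_induced.symm

end

/-! ### A Borel function on the unit interval with dense fibers -/

/-- The real number with digits `0` and `2` in base `4` given by `b`. -/
noncomputable def quaternary (b : ℕ → Bool) : ℝ := Cardinal.cantorFunction (1 / 4) b / 2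

theorem quaternary_eq (b : ℕ → Bool) :
    quaternary b = (if b 0 then 1 / 2 else 0) + quaternary (fun n => b (n + 1)) / 4 := by
  rw [quaternary, Cardinal.cantorFunction_succ b (by norm_num) (by norm_num), quaternary]
  cases b 0 <;> simp <;> ring

theorem quaternary_mono {b c : ℕ → Bool} (h : ∀ n, b n = true → c n = true) :
    quaternary b ≤ quaternary c :=
  div_le_div_of_nonneg_right (Cardinal.cantorFunction_le (by norm_num) (by norm_num) h) (by norm_num)

theorem quaternary_nonneg (b : ℕ → Bool) : 0 ≤ quaternary b := by
  have h := quaternary_mono (b := fun _ => false) (c := b) (by simp)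
  have h' := quaternary_eq fun _ => false
  simp only [Bool.false_eq_true, if_false] at h'
  linarith

theorem quaternary_le (b : ℕ → Bool) : quaternary b ≤ 2 / 3 := by
  have h := quaternary_mono (b := b) (c := fun _ => true) (by simp)
  have h' := quaternary_eq fun _ => true
  simp only [if_true] at h'
  linarith

/-- A leading digit `0` leaves at most `1/6`, since the remaining digits contribute at most `2/3` of
a unit: expansions with digits `0` and `2` are read off without ambiguity. -/
theorem half_le_quaternary_iff {b : ℕ → Bool} : 1 / 2 ≤ quaternary b ↔ b 0 = true := by
  have h := quaternary_eq b
  have h0 := quaternary_nonneg fun n => b (n + 1)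
  have h1 := quaternary_le fun n => b (n + 1)
  cases hb : b 0
  · simp only [hb, Bool.false_eq_true, if_false] at h
    simp only [Bool.false_eq_true, iff_false, not_le]
    linarith
  · simp only [hb, if_true] at h
    simp only [iff_true]
    linarith

theorem exists_pow_mul_quaternary (b : ℕ → Bool) (i : ℕ) :
    ∃ m : ℤ, 4 ^ i * quaternary b = quaternary (fun n => b (n + i)) + m := by
  induction i with
  | zero => exact ⟨0, by simp⟩
  | succ i ih =>
    obtain ⟨m, hm⟩ := ih
    have h := quaternary_eq fun n => b (n + i)
    refine ⟨4 * m + if b (0 + i) then 2 else 0, ?_⟩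
    simp only [add_assoc, add_comm 1 i] at h
    rw [pow_succ', mul_assoc, hm, h]
    push_cast
    split_ifs <;> ring

theorem fract_pow_mul_quaternary (b : ℕ → Bool) (i : ℕ) :
    Int.fract (4 ^ i * quaternary b) = quaternary fun n => b (n + i) := by
  obtain ⟨m, hm⟩ := exists_pow_mul_quaternary b i
  rw [hm, Int.fract_add_intCast, Int.fract_eq_self]
  exact ⟨quaternary_nonneg _, (quaternary_le _).trans_lt (by norm_num)⟩

/-- The `n`-th value tells whether infinitely many digits of `t`, among those with index in the
`n`-th row, are large. -/
noncomputable def rowLimsup (t : unitInterval) (n : ℕ) : Bool := by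
  classical
  exact decide (∃ᶠ k in Filter.atTop, 1 / 2 ≤ Int.fract (4 ^ Nat.pair n k * (t : ℝ)))

theorem measurable_rowLimsup : Measurable rowLimsup := by
  refine measurable_pi_lambda _ fun n => measurable_to_bool ?_
  have h : (fun t => rowLimsup t n) ⁻¹' {true} =
      {t : unitInterval | ∀ a, ∃ k, a ≤ k ∧ 1 / 2 ≤ Int.fract (4 ^ Nat.pair n k * (t : ℝ))} := by
    ext t
    simp [rowLimsup, Filter.frequently_atTop]
  rw [h]
  refine measurableSet_setOfPred.2 (Measurable.forall fun a => Measurable.exists fun k =>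
    measurable_const.and (measurableSet_setOfPred.1 (measurableSet_le measurable_const ?_)))
  exact measurable_fract.comp (measurable_subtype_coe.const_mul _)

/-- Only the tails of the rows matter, so a beginning of the expansion can be used to approximate
`t` while all later digits in row `n` are set to `y n`. -/
theorem dense_rowLimsup_preimage (y : ℕ → Bool) : Dense (rowLimsup ⁻¹' {y}) := by
  rw [Metric.dense_iff]
  intro t ε hε
  obtain ⟨N, hN⟩ := exists_pow_lt_of_lt_one (show 0 < ε / 2 by positivity)
    (show (1 / 4 : ℝ) < 1 by norm_num)
  set b : ℕ → Bool := fun i => y (Nat.unpair (i + N)).1 with hb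
  set s := quaternary b with hs
  -- The factor `4 ^ N - 1` instead of `4 ^ N` keeps `(m + s) / 4 ^ N` at most `1`, even for `t =
  -- 1`.
  set m : ℤ := ⌊(4 ^ N - 1) * (t : ℝ)⌋ with hm
  have h4 : (1 : ℝ) ≤ 4 ^ N := one_le_pow₀ (by norm_num)
  have hs0 := quaternary_nonneg b
  have hs1 := quaternary_le b
  have ht0 := t.2.1
  have ht1 := t.2.2
  have hm0 : (0 : ℝ) ≤ m := by
    exact_mod_cast Int.floor_nonneg.2 (mul_nonneg (by linarith) ht0)
  have hm1 : (m : ℝ) ≤ (4 ^ N - 1) * t := Int.floor_le _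
  have hm2 : (4 ^ N - 1) * t < (m : ℝ) + 1 := Int.lt_floor_add_one _
  have hm3 : (4 ^ N - 1) * (t : ℝ) ≤ 4 ^ N - 1 := mul_le_of_le_one_right (by linarith) ht1
  have hpos : (0 : ℝ) < 4 ^ N := by positivity
  let r : unitInterval := ⟨(m + s) / 4 ^ N, by positivity, by
    rw [div_le_one hpos]
    linarith⟩
  have hr : 4 ^ N * (r : ℝ) = m + s := mul_div_cancel₀ _ hpos.ne'
  refine ⟨r, ?_, ?_⟩
  · have h1 : |4 ^ N * (r : ℝ) - 4 ^ N * t| < 2 := by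
      rw [hr, abs_lt]
      constructor <;> linarith
    rw [← mul_sub, abs_mul, abs_of_pos hpos] at h1
    have h2 : (4 : ℝ) ^ N * (1 / 4) ^ N = 1 := by
      rw [← mul_pow]
      norm_num
    rw [Metric.mem_ball, Subtype.dist_eq, Real.dist_eq]
    refine lt_of_mul_lt_mul_left ?_ hpos.le
    nlinarith
  · have hdigit (i : ℕ) : 1 / 2 ≤ Int.fract (4 ^ (i + N) * (r : ℝ)) ↔ b i = true := by
      have : (4 : ℝ) ^ (i + N) * r = 4 ^ i * s + ((4 ^ i * m : ℤ) : ℝ) := by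
        rw [pow_add, mul_assoc, hr]
        push_cast
        ring
      rw [this, Int.fract_add_intCast, fract_pow_mul_quaternary, half_le_quaternary_iff, zero_add]
    ext n
    have hev : ∀ᶠ k in Filter.atTop,
        (1 / 2 ≤ Int.fract (4 ^ Nat.pair n k * (r : ℝ)) ↔ y n = true) := by
      filter_upwards [Filter.eventually_ge_atTop N] with k hk
      obtain ⟨i, hi⟩ := Nat.exists_eq_add_of_le' (hk.trans (Nat.right_le_pair n k))
      rw [hi, hdigit, hb]
      simp only [← hi, Nat.unpair_pair]
    rw [Bool.eq_iff_iff]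
    simp only [rowLimsup, decide_eq_true_eq, Filter.frequently_congr hev, Filter.frequently_const]

/-! ### Decoding points of the Cantor space which are close to eventually vanishing ones -/

/-- The set of all eventually vanishing points of the Cantor space. -/
def eventuallyFalse : Set (ℕ → Bool) := {x | ∃ M, ∀ k, M ≤ k → x k = false}

theorem measurable_apply_eq {ι : Type*} (i : ι) (b : Bool) :
    Measurable fun x : ι → Bool => x i = b :=
  measurableSet_setOfPred.1 (measurableSet_eq_fun (measurable_pi_apply i) measurable_const)

theorem measurableSet_eventuallyFalse : MeasurableSet eventuallyFalse :=
  measurableSet_setOfPred.2 (Measurable.exists fun _ => Measurable.forall fun k =>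
    measurable_const.imp (measurable_apply_eq k false))

/-- The sequence of the parities of the positions where `x` takes the value `true`. -/
noncomputable def parityDecode (x : ℕ → Bool) (i : ℕ) : Bool := by
  classical
  exact decide (∃ m, x m = true ∧ Odd m ∧ Nat.count (fun k => x k = true) m = i)

theorem measurable_parityDecode : Measurable parityDecode := by
  have hcount (m : ℕ) : Measurable fun x : ℕ → Bool => Nat.count (fun k => x k = true) m := by
    induction m with
    | zero => simp
    | succ m ih =>
      simp only [Nat.count_succ]
      exact ih.add (Measurable.ite (measurableSet_setOfPred.2 (measurable_apply_eq m true))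
        measurable_const measurable_const)
  refine measurable_pi_lambda _ fun i => measurable_to_bool ?_
  have h : (fun x => parityDecode x i) ⁻¹' {true} =
      {x | ∃ m, x m = true ∧ Odd m ∧ Nat.count (fun k => x k = true) m = i} := by
    ext x
    simp [parityDecode]
  rw [h]
  exact measurableSet_setOfPred.2 (Measurable.exists fun m => (measurable_apply_eq m true).and
    (measurable_const.and
      (measurableSet_setOfPred.1 (measurableSet_eq_fun (hcount m) measurable_const))))

/-- Otherwise the counterexamples for all `N` form a decreasing sequence of nonempty compact sets; a
common point vanishes from `M` on, yet is outside `U`. -/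
theorem exists_gap_of_eventuallyFalse_subset {U : Set (ℕ → Bool)} (hU : IsOpen U)
    (h : eventuallyFalse ⊆ U) (M : ℕ) :
    ∃ N, ∀ x : ℕ → Bool, (∀ k, M ≤ k → k < N → x k = false) → x ∈ U := by
  by_contra! hcon
  let t : ℕ → Set (ℕ → Bool) := fun N => {x | ∀ k, M ≤ k → k < N → x k = false} ∩ Uᶜ
  have hclosed (N : ℕ) : IsClosed (t N) := by
    refine IsClosed.inter ?_ hU.isClosed_compl
    simp only [ofPred_forall]
    exact isClosed_iInter fun k => isClosed_iInter fun _ => isClosed_iInter fun _ =>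
      isClosed_eq (continuous_apply k) continuous_const
  have hanti : Antitone t := fun a b hab x hx =>
    ⟨fun k hk hka => hx.1 k hk (hka.trans_le hab), hx.2⟩
  obtain ⟨x, hx⟩ := IsCompact.nonempty_iInter_of_directed_nonempty_isCompact_isClosed t
    hanti.directed_ge (fun N => (hcon N).imp fun x hx => hx) (fun N => (hclosed N).isCompact) hclosed
  rw [mem_iInter] at hx
  exact (hx 0).2 (h ⟨M, fun k hk => (hx (k + 1)).1 k hk (Nat.lt_succ_self k)⟩)

theorem count_of_strictMono {n : ℕ → ℕ} (hn : StrictMono n) {p : ℕ → Prop} [DecidablePred p]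
    (hp : ∀ k, p k ↔ ∃ i, k = n i) (j : ℕ) : Nat.count p (n j) = j := by
  have h : (Finset.range (n j)).filter p = (Finset.range j).image n := by
    ext k
    simp only [Finset.mem_filter, Finset.mem_range, hp, Finset.mem_image]
    constructor
    · rintro ⟨h, i, rfl⟩
      exact ⟨i, hn.lt_iff_lt.1 h, rfl⟩
    · rintro ⟨i, hi, rfl⟩
      exact ⟨hn hi, i, rfl⟩
  rw [Nat.count_eq_card_filter_range, h, Finset.card_image_of_injective _ hn.injective,
    Finset.card_range]

/-- `parityDecode` has continuous right inverses with values in any given `Gδ` set containing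
`eventuallyFalse`. -/
theorem exists_continuous_parityDecode_eq {U : ℕ → Set (ℕ → Bool)} (hU : ∀ n, IsOpen (U n))
    (h : ∀ n, eventuallyFalse ⊆ U n) :
    ∃ ψ : (ℕ → Bool) → ℕ → Bool, Continuous ψ ∧
      ∀ w, (∀ n, ψ w ∈ U n) ∧ ψ w ∉ eventuallyFalse ∧ parityDecode (ψ w) = w := by
  choose f hf using fun n => exists_gap_of_eventuallyFalse_subset (hU n) (h n)
  -- The `i`-th value `true` will be at `2 * N i` or `2 * N i + 1`, its parity recording `w i`. The
  -- next one comes after a gap, starting at `2 * N i + 2`, long enough to force membership in `U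
  -- i`.
  let N : ℕ → ℕ := fun i => Nat.rec 0 (fun i a => f i (2 * a + 2) + a + 1) i
  have hN (i : ℕ) : N (i + 1) = f i (2 * N i + 2) + N i + 1 := rfl
  have hNmono : StrictMono N := strictMono_nat_of_lt_succ fun i => by
    rw [hN]
    omega
  have hle (b : Bool) : b.toNat ≤ 1 := Bool.toNat_le b
  let n : (ℕ → Bool) → ℕ → ℕ := fun w i => 2 * N i + (w i).toNat
  have hn (w) : StrictMono (n w) := fun i j hij => by
    have := hNmono hij
    have := hle (w i)
    simp only [n]
    omega
  classical
  let ψ : (ℕ → Bool) → ℕ → Bool := fun w k => decide (∃ i, k = n w i)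
  have hψ (w : ℕ → Bool) (k : ℕ) : ψ w k = true ↔ ∃ i, k = n w i := by simp [ψ]
  refine ⟨ψ, continuous_pi fun k => ?_, fun w => ⟨fun i => ?_, ?_, ?_⟩⟩
  -- As `i ≤ N i`, the value at `k` depends only on the first `k + 1` entries of `w`.
  · have : (fun w => ψ w k) = (fun v : Fin (k + 1) → Bool =>
        decide (∃ i : Fin (k + 1), k = 2 * N i + (v i).toNat)) ∘ fun w i => w i := by
      ext w
      rw [Bool.eq_iff_iff]
      simp only [ψ, Function.comp, decide_eq_true_eq, n]
      constructor
      · rintro ⟨i, hi⟩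
        have := hNmono.id_le i
        exact ⟨⟨i, by simp only [id] at this; omega⟩, hi⟩
      · rintro ⟨i, hi⟩
        exact ⟨i, hi⟩
    rw [this]
    exact continuous_of_discreteTopology.comp (by fun_prop)
  · refine hf i (2 * N i + 2) _ fun k hk hk' => ?_
    rw [← Bool.not_eq_true, hψ]
    rintro ⟨j, rfl⟩
    have := hN i
    have := hle (w j)
    simp only [n] at hk hk'
    rcases Nat.lt_or_ge i j with hij | hij
    · have := hNmono.monotone (Nat.succ_le_of_lt hij)
      simp only [Nat.succ_eq_add_one] at this
      omega
    · have := hNmono.monotone hij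
      omega
  · rintro ⟨M, hM⟩
    have h1 : ψ w (n w M) = true := (hψ _ _).2 ⟨M, rfl⟩
    rw [hM _ ((hn w).id_le M)] at h1
    exact Bool.false_ne_true h1
  · ext j
    rw [Bool.eq_iff_iff]
    simp only [parityDecode, decide_eq_true_eq, hψ]
    constructor
    · rintro ⟨_, ⟨i, rfl⟩, hodd, hcount⟩
      rw [count_of_strictMono (hn w) (fun k => Iff.rfl)] at hcount
      subst hcount
      by_contra hw
      simp only [n, Bool.eq_false_of_not_eq_true hw, Bool.toNat_false, add_zero] at hodd
      exact Nat.not_odd_iff_even.2 (even_two_mul _) hodd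
    · intro hw
      exact ⟨n w j, ⟨j, rfl⟩, by simp [n, hw], count_of_strictMono (hn w) (fun k => Iff.rfl) j⟩

/-! ### Vertical sections of subsets of products -/

section
variable {C I : Type*} [TopologicalSpace C] [T1Space C] [TopologicalSpace I]

/-- The part of a subset `X` of a product over the point `x`, as a closed subset of `X`. -/
def fiberCloseds (X : Set (C × I)) (x : C) : Closeds X :=
  ⟨{p | p.1.1 = x}, isClosed_singleton.preimage (continuous_fst.comp continuous_subtype_val)⟩

/-- If `X` has dense sections, all of them full over `D`, and `e` is a continuous map from `X` to a
compact space, then all `x` in a certain `Gδ` set containing `D` are points of continuity of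
`fiberCloseds X`, in the topology given by `e`. -/
theorem exists_continuous_fiberCloseds [CompactSpace I] {K : Type*} [TopologicalSpace K]
    [CompactSpace K] [MetrizableSpace K] {X : Set (C × I)} {D : Set C}
    (hD : ∀ x ∈ D, ∀ t, (x, t) ∈ X) (hX : ∀ x, Dense {t | (x, t) ∈ X}) {e : X → K}
    (he : Continuous e) :
    ∃ U : ℕ → Set C, (∀ n, IsOpen (U n)) ∧ (∀ n, D ⊆ U n) ∧
      ∀ {S : Type*} [TopologicalSpace S] (ψ : S → C), Continuous ψ → (∀ w n, ψ w ∈ U n) →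
        @Continuous _ _ _ (hyperspaceTopology e) fun w => fiberCloseds X (ψ w) := by
  let := metrizableSpaceMetric K
  -- The points, possibly outside `X`, where `e` has oscillation less than `1 / (n + 1)` on some
  -- neighborhood. The `n`-th open set consists of all `x` whose entire fiber lies in `O n`; it is
  -- open because projection along the compact `I` is closed.
  let O : ℕ → Set (C × I) := fun n =>
    ⋃₀ {V | IsOpen V ∧ ∀ a b : X, a.1 ∈ V → b.1 ∈ V → dist (e a) (e b) < 1 / (n + 1)}
  have hO (n : ℕ) : IsOpen (O n) := isOpen_sUnion fun V hV => hV.1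
  refine ⟨fun n => (Prod.fst '' (O n)ᶜ)ᶜ,
    fun n => (isClosedMap_fst_of_compactSpace _ (hO n).isClosed_compl).isOpen_compl,
    fun n x hx => ?_, ?_⟩
  · rintro ⟨⟨x, t⟩, hxt, rfl⟩
    apply hxt
    let p : X := ⟨(x, t), hD x hx t⟩
    obtain ⟨V, hV, hVe⟩ := isOpen_induced_iff.1
      ((Metric.isOpen_ball (x := e p) (ε := 1 / (n + 1) / 2)).preimage he)
    have hmem (a : X) : a.1 ∈ V ↔ dist (e a) (e p) < 1 / (n + 1) / 2 := by
      rw [← mem_preimage, hVe]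
      rfl
    refine ⟨V, ⟨hV, fun a b ha hb => ?_⟩, (hmem p).2 (by rw [dist_self]; positivity)⟩
    rw [hmem] at ha hb
    linarith [dist_triangle_right (e a) (e b) (e p)]
  · intro S _ ψ hψ hψU
    have hψO (w : S) (n : ℕ) (t : I) : (ψ w, t) ∈ O n := by
      by_contra h
      exact hψU w n ⟨_, h, rfl⟩
    refine continuous_induced_rng.2 (continuous_generateFrom_iff.2 ?_)
    rintro _ (⟨V, hV, rfl⟩ | ⟨V, hV, rfl⟩)
    · rw [isOpen_iff_mem_nhds]
      intro w hw
      set F := fiberCloseds X (ψ w) with hF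
      obtain ⟨δ, hδ, hδ'⟩ := (disjoint_compl_right_iff_subset.2 hw).exists_thickenings
        isClosed_closure.isCompact hV.isClosed_compl
      obtain ⟨n, hn⟩ := exists_nat_one_div_lt hδ
      -- Even if `(ψ w, t)` is not in `X`, density provides a point of `X` over `ψ w` in the same
      -- set of small oscillation; compactness of `I` makes this uniform in `t`.
      have hev : ∀ᶠ x in nhds (ψ w), ∀ t ∈ (univ : Set I), ∀ h : (x, t) ∈ X,
          e ⟨(x, t), h⟩ ∈ Metric.thickening δ (closure (e '' (F : Set X))) := by
        refine isCompact_univ.eventually_forall_of_forall_eventually fun t _ => ?_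
        obtain ⟨W, ⟨hW, hWe⟩, hWt⟩ := hψO w n t
        obtain ⟨s, hsW, hsX⟩ := (hX (ψ w)).inter_open_nonempty _
          (hW.preimage (Continuous.prodMk_right (ψ w))) ⟨t, hWt⟩
        filter_upwards [hW.mem_nhds hWt] with q hq h
        exact Metric.mem_thickening_iff.2 ⟨e ⟨(ψ w, s), hsX⟩,
          subset_closure (mem_image_of_mem e rfl), (hWe ⟨q, h⟩ ⟨(ψ w, s), hsX⟩ hq hsW).trans hn⟩
      filter_upwards [hψ.continuousAt hev] with w' hw'
      have hsub : e '' (fiberCloseds X (ψ w') : Set X) ⊆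
          Metric.thickening δ (closure (e '' (F : Set X))) := by
        rintro _ ⟨⟨⟨x, t⟩, h⟩, rfl, rfl⟩
        exact hw' t trivial h
      have hdisj := (hδ'.mono_left hsub).closure_left Metric.isOpen_thickening
      exact disjoint_compl_right_iff_subset.1
        (hdisj.mono_right (Metric.self_subset_thickening hδ _))
    · obtain ⟨W, hW, hWe⟩ := isOpen_induced_iff.1 (hV.preimage he)
      -- Since sections are dense, one meets the open set `W` as soon as the full fiber does. This
      -- half needs no small oscillation.
      have : (fun w => closure (e '' (fiberCloseds X (ψ w) : Set X))) ⁻¹' {s | (s ∩ V).Nonempty} =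
          ψ ⁻¹' (Prod.fst '' W) := by
        ext w
        rw [mem_preimage, mem_ofPred_eq, closure_image_inter_nonempty_iff hV, ← hWe]
        constructor
        · rintro ⟨p, hpw, hp⟩
          exact ⟨p.1, hp, hpw⟩
        · rintro ⟨⟨x, t⟩, hxt, rfl⟩
          obtain ⟨s, hsW, hsX⟩ := (hX (ψ w)).inter_open_nonempty _
            (hW.preimage (Continuous.prodMk_right (ψ w))) ⟨t, hxt⟩
          exact ⟨⟨(ψ w, s), hsX⟩, rfl, hsW⟩
      change IsOpen ((fun w => closure (e '' (fiberCloseds X (ψ w) : Set X))) ⁻¹' _)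
      rw [this]
      exact (isOpenMap_fst _ hW).preimage hψ

/-- A section of `X` whose complement is dense in a linear order is zero-dimensional. -/
theorem fiberCloseds_mem_closedZeroDim [LinearOrder I] [OrderTopology I] [DenselyOrdered I]
    {X : Set (C × I)} {x : C} (h : Dense {t | (x, t) ∉ X}) :
    fiberCloseds X x ∈ closedZeroDim X := by
  refine (hasSmallInductiveDimensionLT_one_iff (X := fiberCloseds X x)).2 ?_
  let τ : fiberCloseds X x → I := fun p => p.1.1.2
  have hτ : Topology.IsInducing τ := by
    refine Topology.IsInducing.of_comp (g := Prod.mk x) (by fun_prop) (by fun_prop) ?_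
    have : Prod.mk x ∘ τ = fun p => p.1.1 := by
      ext1 p
      exact Prod.ext p.2.symm rfl
    rw [this]
    exact Topology.IsInducing.subtypeVal.comp Topology.IsInducing.subtypeVal
  have hne {t : I} (ht : (x, t) ∉ X) (p : fiberCloseds X x) : τ p ≠ t := by
    rintro rfl
    have hp : p.1.1 = (x, τ p) := Prod.ext p.2 rfl
    exact ht (hp ▸ p.1.2)
  -- Rays with endpoints in the dense set of omitted values generate the topology, and their traces
  -- on the section are clopen.
  have hgen := hτ.eq_induced.trans
    ((congrArg (induced τ) h.topology_eq_generateFrom).trans induced_generateFrom_eq)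
  refine (isTopologicalBasis_of_subbasis hgen).of_isOpen_of_subset (fun U hU => hU.2) ?_
  rintro _ ⟨T, ⟨hT, hTs⟩, rfl⟩
  change IsClopen (⋂₀ T)
  rw [sInter_eq_biInter]
  refine hT.isClopen_biInter fun V hV => ?_
  obtain ⟨_, ⟨t, ht, rfl⟩ | ⟨t, ht, rfl⟩, rfl⟩ := hTs hV
  · refine ⟨?_, isOpen_Ioi.preimage hτ.continuous⟩
    convert isClosed_Ici.preimage hτ.continuous (t := Ici t) using 1
    ext p
    exact ⟨le_of_lt, fun hp => lt_of_le_of_ne hp (hne ht p).symm⟩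
  · refine ⟨?_, isOpen_Iio.preimage hτ.continuous⟩
    convert isClosed_Iic.preimage hτ.continuous (t := Iic t) using 1
    ext p
    exact ⟨le_of_lt, fun hp => lt_of_le_of_ne hp (hne ht p)⟩

/-- A full section of `X` is not zero-dimensional. -/
theorem fiberCloseds_notMem_closedZeroDim [T1Space I] [PreconnectedSpace I] [Nontrivial I]
    {X : Set (C × I)} {x : C} (h : ∀ t, (x, t) ∈ X) : fiberCloseds X x ∉ closedZeroDim X := by
  intro hz
  have hb := (hasSmallInductiveDimensionLT_one_iff (X := fiberCloseds X x)).1 hz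
  let σ : I → fiberCloseds X x := fun t => ⟨⟨(x, t), h t⟩, rfl⟩
  have hσ : Continuous σ := by fun_prop
  obtain ⟨s, t, hst⟩ := exists_pair_ne I
  have hσst : σ s ≠ σ t := fun heq => hst (congrArg (fun p : fiberCloseds X x => p.1.1.2) heq)
  obtain ⟨V, hV, hsV, hVt⟩ := hb.exists_subset_of_mem_open (u := {σ t}ᶜ) hσst
    isOpen_compl_singleton
  rcases isClopen_iff.1 (hV.preimage hσ) with h | h
  · exact (h ▸ hsV : s ∈ (∅ : Set I))
  · exact hVt (h ▸ mem_univ t : t ∈ σ ⁻¹' V) rfl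

end

/-! ### A universal set and the hard space -/

/-- There is an analytic subset of the square of the Cantor space which is universal for the
`Σ¹₂` sets defined as sets of all parameters of proper sections. -/
theorem exists_universal_analyticSet :
    ∃ V : Set ((ℕ → Bool) × (ℕ → Bool)), AnalyticSet V ∧
      ∀ A : Set (ℕ → Bool), IsPCA A → ∃ θ : (ℕ → Bool) → ℕ → Bool, Continuous θ ∧
        ∀ z, z ∈ A ↔ ∃ y, (θ z, y) ∉ V := by
  let η : (ℕ → Bool) ≃ᵐ (ℕ → ℕ) := PolishSpace.measurableEquivOfNotCountable
    (not_countable_iff.2 (Cardinal.aleph0_lt_mk_iff.1 (by simp [Cardinal.aleph0_lt_continuum])))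
    (not_countable_iff.2 (Cardinal.aleph0_lt_mk_iff.1 (by simp [Cardinal.aleph0_lt_continuum])))
  obtain ⟨B, hB⟩ := exists_seq_isTopologicalBasis (((ℕ → Bool) × (ℕ → ℕ)) × (ℕ → ℕ))
  have hBo (n : ℕ) : IsOpen (B n) := hB.isOpen ⟨n, rfl⟩
  -- The even coordinates of the parameter carry the point `z`; the odd ones code a closed set by
  -- listing basic sets disjoint from it. The Borel isomorphism `η` replaces the Baire space by the
  -- Cantor space.
  refine ⟨Prod.fst '' {q : ((ℕ → Bool) × (ℕ → Bool)) × (ℕ → ℕ) | ∀ n, q.1.1 (2 * n + 1) = true →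
    ((fun k => q.1.1 (2 * k), η q.1.2), q.2) ∉ B n}, ?_, ?_⟩
  · refine MeasurableSet.analyticSet_image (measurableSet_setOfPred.2 ?_) measurable_fst
    refine Measurable.forall fun n => Measurable.imp
      ((measurable_apply_eq (2 * n + 1) true).comp (by fun_prop)) (Measurable.not ?_)
    refine (measurableSet_setOfPred.1 (hBo n).measurableSet).comp (Measurable.prodMk
      (Measurable.prodMk ?_ ?_) measurable_snd)
    · exact measurable_pi_lambda _ fun k => (measurable_pi_apply (2 * k)).comp (by fun_prop)
    · exact η.measurable.comp (by fun_prop)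
  · rintro _ ⟨C, hC, rfl⟩
    obtain ⟨H, hH, hHC⟩ : ∃ H : Set (((ℕ → Bool) × (ℕ → ℕ)) × (ℕ → ℕ)), IsClosed H ∧
        Cᶜ = Prod.fst '' H := by
      rw [AnalyticSet] at hC
      rcases hC with hC | ⟨f, hf, hC⟩
      · exact ⟨∅, isClosed_empty, by simp [hC]⟩
      · exact ⟨{q | f q.2 = q.1}, isClosed_eq (hf.comp continuous_snd) continuous_fst, by
          rw [← hC]
          ext
          simp⟩
    classical
    let c : ℕ → Bool := fun n => decide (B n ⊆ Hᶜ)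
    have hc (q) : (∀ n, c n = true → q ∉ B n) ↔ q ∈ H := by
      constructor
      · intro h
        by_contra hq
        obtain ⟨n, hn, hn'⟩ := exists_basis_index hB hH.isOpen_compl hq
        exact h n (decide_eq_true hn') hn
      · exact fun hq n hn hqn => of_decide_eq_true hn hqn hq
    let θ : (ℕ → Bool) → ℕ → Bool := fun z k => if Even k then z (k / 2) else c (k / 2)
    have hθ0 (z : ℕ → Bool) : (fun k => θ z (2 * k)) = z := by
      ext k
      simp [θ]
    have hθ1 (z : ℕ → Bool) (k : ℕ) : θ z (2 * k + 1) = c k := by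
      have h1 : (2 * k + 1) / 2 = k := by omega
      simp [θ, h1]
    refine ⟨θ, continuous_pi fun k => ?_, fun z => ?_⟩
    · simp only [θ]
      split_ifs <;> fun_prop
    · have hV (y : ℕ → Bool) : (z, η y) ∈ C ↔ ¬ ∃ u, ((z, η y), u) ∈ H := by
        rw [← notMem_compl_iff, hHC]
        simp
      simp only [mem_image, Prod.exists, exists_and_right, exists_eq_right, mem_ofPred_eq, hθ0, hθ1,
        hc]
      rw [η.surjective.exists (p := fun v => (z, v) ∈ C)]
      simp only [hV]

/-- A set in the product of the Cantor space and the interval, such that the family of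
its closed zero-dimensional subsets is `Σ¹₂`-hard when `V` is universal. -/
def sigma12HardSpace (V : Set ((ℕ → Bool) × (ℕ → Bool))) : Set ((ℕ → Bool) × unitInterval) :=
  {q | q.1 ∈ eventuallyFalse ∨ rowLimsup q.2 0 = false ∨
    (parityDecode q.1, fun n => rowLimsup q.2 (n + 1)) ∈ V}

theorem analyticSet_sigma12HardSpace {V : Set ((ℕ → Bool) × (ℕ → Bool))} (hV : AnalyticSet V) :
    AnalyticSet (sigma12HardSpace V) := by
  refine AnalyticSet.union (measurableSet_eventuallyFalse.preimage measurable_fst).analyticSet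
    (AnalyticSet.union (MeasurableSet.analyticSet (measurableSet_setOfPred.2
      ((measurable_apply_eq 0 false).comp (measurable_rowLimsup.comp measurable_snd))))
      (AnalyticSet.preimage_of_measurable hV (f := fun q : (ℕ → Bool) × unitInterval =>
        (parityDecode q.1, fun n => rowLimsup q.2 (n + 1))) ?_))
  exact (measurable_parityDecode.comp measurable_fst).prodMk (measurable_pi_lambda _ fun n =>
    (measurable_pi_apply (n + 1)).comp (measurable_rowLimsup.comp measurable_snd))

theorem isSigma12Hard_sigma12HardSpace {V : Set ((ℕ → Bool) × (ℕ → Bool))}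
    (hV : ∀ A : Set (ℕ → Bool), IsPCA A → ∃ θ : (ℕ → Bool) → ℕ → Bool, Continuous θ ∧
        ∀ z, z ∈ A ↔ ∃ y, (θ z, y) ∉ V)
    {t : TopologicalSpace (Closeds (sigma12HardSpace V))} (ht : IsAdmissible.{0, v} t) :
    IsSigma12Hard t (closedZeroDim (sigma12HardSpace V)) := by
  obtain ⟨K, _, _, _, e, he, rfl⟩ := ht
  intro A hA
  obtain ⟨θ, hθ, hθA⟩ := hV A hA
  obtain ⟨U, hU, hDU, hcont⟩ := exists_continuous_fiberCloseds (X := sigma12HardSpace V)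
    (D := eventuallyFalse) (fun x hx t => Or.inl hx)
    (fun x => (dense_rowLimsup_preimage fun _ => false).mono
      fun t ht => Or.inr (Or.inl (congrFun ht 0))) he.continuous
  obtain ⟨ψ, hψ, hψ'⟩ := exists_continuous_parityDecode_eq hU hDU
  refine ⟨fun z => fiberCloseds _ (ψ (θ z)),
    hcont (fun z => ψ (θ z)) (hψ.comp hθ) fun z n => (hψ' (θ z)).1 n, ?_⟩
  ext z
  obtain ⟨-, hD, hdec⟩ := hψ' (θ z)
  rw [hθA, mem_preimage]
  by_cases h : ∃ y, (θ z, y) ∉ V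
  · refine iff_of_true h (fiberCloseds_mem_closedZeroDim ?_)
    obtain ⟨y, hy⟩ := h
    -- The entry `true` in row `0` rules out the clause that made the sections dense; the other rows
    -- carry the witness `y`.
    refine (dense_rowLimsup_preimage fun n => Nat.casesOn n true y).mono fun t ht => ?_
    have ht : rowLimsup t = _ := ht
    rintro (h | h | h)
    · exact hD h
    · rw [ht] at h
      exact Bool.false_ne_true h.symm
    · rw [hdec, ht] at h
      exact hy h
  · refine iff_of_false h (fiberCloseds_notMem_closedZeroDim fun t => Or.inr (Or.inr ?_))
    rw [hdec]
    exact not_not.1 (not_exists.1 h _)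

theorem mainTheorem1 :
    (∀ (X : Type u) [TopologicalSpace X] [MetrizableSpace X] [SeparableSpace X],
      AnalyticSet (univ : Set X) →
        IsBorelSigma12.{u, v} (effrosBorel X) (closedZeroDim X) ∧
        ∀ t : TopologicalSpace (Closeds X), IsAdmissible.{u, v} t →
          IsSigma12.{u, v} t (closedZeroDim X)) ∧
    ∃ X : Set ((ℕ → Bool) × unitInterval), AnalyticSet X ∧
      ∀ t : TopologicalSpace (Closeds X), IsAdmissible.{0, v} t →
        IsSigma12Complete.{0, v} t (closedZeroDim X) := by
  constructor
  · intro X _ _ _ hX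
    let := metrizableSpaceMetric X
    have := UniformSpace.secondCountable_of_separable X
    exact ⟨isBorelSigma12_closedZeroDim hX, fun t ht => isSigma12_closedZeroDim hX ht⟩
  · obtain ⟨V, hVa, hV⟩ := exists_universal_analyticSet
    have hX := analyticSet_sigma12HardSpace hVa
    refine ⟨sigma12HardSpace V, hX, fun t ht =>
      ⟨isSigma12_closedZeroDim ?_ ht, isSigma12Hard_sigma12HardSpace hV ht⟩⟩
    rw [AnalyticSet] at hX ⊢
    rcases hX with h | ⟨f, hf, h⟩
    · exact Or.inl (univ_eq_empty_iff.2 (isEmpty_coe_sort.2 h))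
    · refine Or.inr ⟨codRestrict f _ fun y => h ▸ mem_range_self y, hf.codRestrict _, ?_⟩
      refine eq_univ_of_forall fun ⟨q, hq⟩ => ?_
      rw [← h] at hq
      exact hq.imp fun y hy => Subtype.ext hy
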